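/- **Bulk replacement lemma for SEP($\alpha$) with open boundary.** Let $\alpha\ge 1$ be an integer, let $\varepsilon,\gamma,\beta,\delta>0$, $\theta\in\mathbb R$ and $T>0$. For $N\ge 1$ let $\Lambda_N=\{1,\dots,N-1\}$ and $\Omega_N=\{0,\dots,\alpha\}^{\Lambda_N}$. Let $\mathcal L_N$ be the Markov generator which acts on $f:\Omega_N\to\mathbb R$ by $$\begin{aligned}\mathcal L_N f(\eta)={}&\sum_{x=1}^{N-2}\Big(\eta(x)[\alpha-\eta(x+1)]\{f(\eta^{x,x+1})-f(\eta)\}+\eta(x+1)[\alpha-\eta(x)]\{f(\eta^{x+1,x})-f(\eta)\}\Big)\\&+\frac{1}{N^\theta}\Big(\gamma\,\eta(1)\{f(\eta^{1,0})-f(\eta)\}+\varepsilon[\alpha-\eta(1)]\{f(\eta^{0,1})-f(\eta)\}\Big)\\&+\frac{1}{N^\theta}\Big(\beta\,\eta(N-1)\{f(\eta^{N-1,N})-f(\eta)\}+\delta[\alpha-\eta(N-1)]\{f(\eta^{N,N-1})-f(\eta)\}\Big),\end{aligned}$$ where $\eta^{x,y}$ is obtained from $\eta$ by moving one particle from $x$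 to $y$; here a particle is created when it comes from the reservoirs $0$ or $N$ and removed when it goes to them. For each $N$ let $\mu_N$ be an arbitrary probability measure on $\Omega_N$, and let $(\eta_{sN^2})_{0\le s\le T}$ be the càdlàg Markov chain on $\Omega_N$ with generator $N^2\mathcal L_N$ and initial distribution $\mu_N$; $\mathbb E_{\mu_N}$ denotes expectation with respect to its law. For an integer $L\ge1$ put $$\overrightarrow{\eta}^{L}(z)=\frac1L\sum_{y=z+1}^{z+L}\eta(y),\qquad \overleftarrow{\eta}^{L}(z)=\frac1L\sum_{y=z-L}^{z-1}\eta(y).$$ Then for every $t\in[0,T]$ $$\lim_{\kappa\to0^+}\ \limsup_{N\to\infty}\ \mathbb E_{\mu_N}\Big[\Big|\int_0^t\Big(\eta_{sN^2}(1)-\overrightarrow{\eta}^{\lfloor\kappa N\rfloor}_{sN^2}(1)\Big)ds\Big|\Big]=0$$ and $$\lim_{\kappa\to0^+}\ \limsup_{N\to\infty}\ \mathbb E_{\mu_N}\Big[\Big|\int_0^t\Big(\eta_{sN^2}(N-1)-\overleftarrow{\eta}^{\lfloor\kappa N\rfloor}_{sN^2}(N-1)\Big)ds\Big|\Big]=0.$$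 -/

import Mathlib

open MeasureTheory Filter Topology

noncomputable section

namespace SEP

/-- The bulk `Λ_N = {1, …, N-1}`. -/
abbrev Site (N : ℕ) : Type := {x : ℕ // x ∈ Finset.Icc 1 (N - 1)}

/-- The state space `Ω_N = {0, …, α}^{Λ_N}`. -/
abbrev Config (α N : ℕ) : Type := Site N → Fin (α + 1)

variable {α N : ℕ}

/-- The number `η(x)` of particles at the site `x` (and `0` if `x` is outside the bulk). -/
def occ (η : Config α N) (x : ℕ) : ℕ :=
  if h : x ∈ Finset.Icc 1 (N - 1) then (η ⟨x, h⟩ : ℕ) else 0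

/-- Add one particle at `x`, unless the site already has `α` particles. -/
def inject (η : Config α N) (x : ℕ) : Config α N := fun z =>
  if (z : ℕ) = x then ⟨min ((η z : ℕ) + 1) α, by omega⟩ else η z

/-- Remove one particle from `x`, unless the site is empty. -/
def remove (η : Config α N) (x : ℕ) : Config α N := fun z =>
  if (z : ℕ) = x then ⟨(η z : ℕ) - 1, by omega⟩ else η z

/-- `η^{x,y}`: one particle is moved from `x` to `y`. It is only used with the rate
`jumpRate η x y`, which vanishes when `x` is empty or `y` is full. -/
def move (η : Config α N) (x y : ℕ) : Config α N := inject (remove η x) y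

/-- The bulk jump rate `c_{x,y}(η) = η(x) [α - η(y)]`. -/
def jumpRate (η : Config α N) (x y : ℕ) : ℝ := (occ η x : ℝ) * ((α : ℝ) - occ η y)

/-- The left boundary generator, with injection rate `ε` and absorption rate `γ`. -/
def leftGenerator (ε γ θ : ℝ) (f : Config α N → ℝ) (η : Config α N) : ℝ :=
  1 / (N : ℝ) ^ θ * (γ * (occ η 1 : ℝ)) * (f (remove η 1) - f η)
    + 1 / (N : ℝ) ^ θ * (ε * ((α : ℝ) - occ η 1)) * (f (inject η 1) - f η)

/-- The bulk generator. -/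
def bulkGenerator (f : Config α N → ℝ) (η : Config α N) : ℝ :=
  ∑ x ∈ Finset.Icc 1 (N - 2),
    (jumpRate η x (x + 1) * (f (move η x (x + 1)) - f η)
      + jumpRate η (x + 1) x * (f (move η (x + 1) x) - f η))

/-- The right boundary generator, with injection rate `δ` and absorption rate `β`. -/
def rightGenerator (β δ θ : ℝ) (f : Config α N → ℝ) (η : Config α N) : ℝ :=
  1 / (N : ℝ) ^ θ * (β * (occ η (N - 1) : ℝ)) * (f (remove η (N - 1)) - f η)
    + 1 / (N : ℝ) ^ θ * (δ * ((α : ℝ) - occ η (N - 1))) * (f (inject η (N - 1)) - f η)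

/-- The generator `L_N` of the exclusion process SEP(α) with open boundary. -/
def generator (ε γ β δ θ : ℝ) (f : Config α N → ℝ) (η : Config α N) : ℝ :=
  leftGenerator ε γ θ f η + bulkGenerator f η + rightGenerator β δ θ f η

/-- The matrix of the generator `L_N`: the entry at `(η, ξ)` is `(L_N 1_{ξ})(η)`. -/
def generatorMatrix (α N : ℕ) (ε γ β δ θ : ℝ) : Matrix (Config α N) (Config α N) ℝ :=
  Matrix.of fun η ξ => generator ε γ β δ θ (Pi.single ξ 1) η

/-- `(X_t)_{0 ≤ t ≤ T}` is, under `P`, a càdlàg continuous-time Markov chain on the finite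
(discrete) set `S`, with initial distribution `μ` and with generator matrix `Q`, that is, with
transition probabilities `p_t(a, b) = exp(tQ)(a, b)`. -/
structure IsMarkovChain {S : Type*} [Fintype S] [DecidableEq S] [TopologicalSpace S]
    [MeasurableSpace S] (T : ℝ) (Q : Matrix S S ℝ) (μ : Measure S)
    {Ω : Type*} [MeasurableSpace Ω] (P : Measure Ω) (X : ℝ → Ω → S) : Prop where
  measurable : ∀ t ∈ Set.Icc 0 T, Measurable (X t)
  right_continuous : ∀ ω, ∀ t ∈ Set.Ico 0 T,
    ContinuousWithinAt (fun s => X s ω) (Set.Ici t) t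
  left_limit : ∀ ω, ∀ t ∈ Set.Ioc 0 T, ∃ a, Tendsto (fun s => X s ω) (𝓝[<] t) (𝓝 a)
  finite_dim : ∀ (n : ℕ) (s : Fin (n + 1) → ℝ) (a : Fin (n + 1) → S),
    s 0 = 0 → Monotone s → s (Fin.last n) ≤ T →
      P {ω | ∀ i, X (s i) ω = a i} =
        μ {a 0} * ∏ i : Fin n, ENNReal.ofReal
          (NormedSpace.exp ((s i.succ - s i.castSucc) • Q) (a i.castSucc) (a i.succ))

/-- `(X_t)_{0 ≤ t ≤ T}` is a version of the process `(η_{tN²})_{0 ≤ t ≤ T}`: the SEP(α) process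
accelerated by `N²` (its generator is `N² L_N`), started from the distribution `μ`. -/
def IsAcceleratedSEP (α N : ℕ) (ε γ β δ θ T : ℝ) (μ : Measure (Config α N))
    {Ω : Type*} [MeasurableSpace Ω] (P : Measure Ω) (X : ℝ → Ω → Config α N) : Prop :=
  IsMarkovChain T (((N : ℝ) ^ 2) • generatorMatrix α N ε γ β δ θ) μ P X

/-- The average of `η` over the `L` sites to the right of `z`. -/
def rightAverage (η : Config α N) (L z : ℕ) : ℝ :=
  1 / (L : ℝ) * ∑ y ∈ Finset.Icc (z + 1) (z + L), (occ η y : ℝ)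

/-- The average of `η` over the `L` sites to the left of `z`. -/
def leftAverage (η : Config α N) (L z : ℕ) : ℝ :=
  1 / (L : ℝ) * ∑ y ∈ Finset.Ico (z - L) z, (occ η y : ℝ)

end SEP

end

/-! The replacement is the integral of a generator, with no entropy or Dirichlet form estimate.
SEP(α) is gradient: the quadratic terms of the two rates across a bond cancel, so `generator` maps
`∑ φ(x) η(x)` to `∑ α (φ(x+1) - φ(x)) (η(x) - η(x+1))` as soon as `φ` vanishes at `1` and `N - 1`.
The reservoirs then play no role, whatever `θ`.

With `L = ⌊κN⌋`, the difference between `η(1)` and its average is `∑ g(x) (η(x) - η(x+1))` with `∑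
|g| ≤ L`. Subtracting from `g` its mean `c = O(κ)` gives a function whose primitive vanishes at both
ends. Hence the difference equals `N² L_N f` up to an error `O(κ)`, where `|f| ≤ (N-1)·2L/N² = O(κ)`
(`exists_generator_eq`).

For a chain with generator `Q`, the second moment of `∫₀ᵗ Qf(X_s) ds` is twice the integral over `s
< r` of `E[Qf(X_s) Qf(X_r)]`. This integrand is the `r`-derivative of `E[Qf(X_s) f(X_r)]`, so the
second moment is at most `4t sup|Qf| sup|f|` (`integral_sq_mulVec_le`). Here it is `O(κ)`, for every
initial law, and the first moment is `O(√κ)`. -/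

noncomputable section

namespace SEP

/-! ### Second moments of time integrals -/

section SquareIntegral

variable {Ω : Type*} [MeasurableSpace Ω]

/-- The second moment of a time integral is controlled by the integrated correlations of the
process with its own future. -/
theorem integral_sq_timeIntegral_le (P : Measure Ω) [IsProbabilityMeasure P] (Z : ℝ → Ω → ℝ)
    (hZ : Measurable (Function.uncurry Z)) {w : ℝ} (hw : ∀ s ω, |Z s ω| ≤ w) {t B : ℝ}
    (ht : 0 ≤ t)
    (hK : ∀ s ∈ Set.Icc 0 t, |∫ r in s..t, ∫ ω, Z s ω * Z r ω ∂P| ≤ B) :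
    ∫ ω, (∫ s in (0 : ℝ)..t, Z s ω) ^ 2 ∂P ≤ 2 * t * B := by
  set ν : Measure ℝ := volume.restrict (Set.Ioc 0 t) with hν
  set K : ℝ × ℝ → ℝ := fun p => ∫ ω, Z p.1 ω * Z p.2 ω ∂P with hKdef
  have hm : Measurable fun q : Ω × (ℝ × ℝ) => Z q.2.1 q.1 * Z q.2.2 q.1 := by
    have h1 : Measurable fun q : Ω × (ℝ × ℝ) => Z q.2.1 q.1 :=
      hZ.comp ((measurable_fst.comp measurable_snd).prodMk measurable_fst)
    have h2 : Measurable fun q : Ω × (ℝ × ℝ) => Z q.2.2 q.1 :=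
      hZ.comp ((measurable_snd.comp measurable_snd).prodMk measurable_fst)
    exact h1.mul h2
  have hb : ∀ s r ω, |Z s ω * Z r ω| ≤ w * w := fun s r ω => by
    rw [abs_mul]
    exact mul_le_mul (hw s ω) (hw r ω) (abs_nonneg _) ((abs_nonneg _).trans (hw s ω))
  have hint : Integrable (fun q : Ω × (ℝ × ℝ) => Z q.2.1 q.1 * Z q.2.2 q.1)
      (P.prod (ν.prod ν)) :=
    Integrable.of_bound hm.aestronglyMeasurable (w * w) (Eventually.of_forall fun q => hb _ _ _)
  have hKm : StronglyMeasurable K := by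
    have := (hm.comp measurable_swap).stronglyMeasurable
    exact this.integral_prod_right' (ν := P)
  have hKb : ∀ p, |K p| ≤ w * w := fun p => by
    have := norm_integral_le_of_norm_le_const (μ := P) (C := w * w)
      (f := fun ω => Z p.1 ω * Z p.2 ω) (Eventually.of_forall fun ω => hb p.1 p.2 ω)
    simpa using this
  have e1 : ∫ ω, (∫ s in (0 : ℝ)..t, Z s ω) ^ 2 ∂P = ∫ p, K p ∂(ν.prod ν) := by
    rw [hKdef, ← integral_integral_swap hint]
    congr 1
    ext ω
    rw [intervalIntegral.integral_of_le ht, sq, ← integral_prod_mul (fun s => Z s ω)]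
  -- The square is cut into two triangles exchanged by symmetry. One is strict and one is not, so
  -- that the diagonal is counted exactly once after the swap.
  set S1 : Set (ℝ × ℝ) := {p | p.1 < p.2} with hS1
  set S2 : Set (ℝ × ℝ) := {p | p.1 ≤ p.2} with hS2
  have hS1m : MeasurableSet S1 := measurableSet_lt measurable_fst measurable_snd
  have hS2m : MeasurableSet S2 := measurableSet_le measurable_fst measurable_snd
  have hKi : Integrable K (ν.prod ν) :=
    Integrable.of_bound hKm.aestronglyMeasurable (w * w) (Eventually.of_forall hKb)
  have hsymm : ∀ p, K p.swap = K p := fun p => by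
    simp only [hKdef, Prod.fst_swap, Prod.snd_swap]
    congr 1; ext ω; ring
  have e2 : ∫ p, K p ∂(ν.prod ν)
      = ∫ p, S1.indicator K p ∂(ν.prod ν) + ∫ p, S2.indicator K p ∂(ν.prod ν) := by
    have hsw : Integrable (fun p => S2.indicator K (Prod.swap p)) (ν.prod ν) :=
      (hKi.indicator hS2m).swap
    rw [← integral_prod_swap (S2.indicator K), ← integral_add (hKi.indicator hS1m) hsw]
    congr 1
    ext p
    by_cases h : p.1 < p.2
    · have h' : ¬ p.2 ≤ p.1 := not_le.2 h
      simp [Set.indicator, hS1, hS2, h, h']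
    · have h' : p.2 ≤ p.1 := not_lt.1 h
      simp [Set.indicator, hS1, hS2, h, h', hsymm]
  have key : ∀ S : Set (ℝ × ℝ), MeasurableSet S →
      (∀ s ∈ Set.Ioc 0 t, ∫ r, S.indicator K (s, r) ∂ν = ∫ r in s..t, K (s, r)) →
      ∫ p, S.indicator K p ∂(ν.prod ν) ≤ t * B := by
    intro S hS h
    rw [integral_prod _ (hKi.indicator hS)]
    have hB : 0 ≤ B := (abs_nonneg _).trans (hK 0 ⟨le_rfl, ht⟩)
    have := norm_setIntegral_le_of_norm_le_const (μ := volume) (s := Set.Ioc (0 : ℝ) t) (C := B)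
      (f := fun s => ∫ r, S.indicator K (s, r) ∂ν) (by simp)
      (fun s hs => by rw [h s hs]; exact hK s ⟨hs.1.le, hs.2⟩)
    refine (le_abs_self _).trans (this.trans (le_of_eq ?_))
    simp [ht, mul_comm]
  have k1 := key S1 hS1m fun s hs => by
    rw [intervalIntegral.integral_of_le hs.2, hν,
      ← integral_indicator measurableSet_Ioc, ← integral_indicator measurableSet_Ioc]
    congr 1
    ext r
    simp only [Set.indicator, hS1, Set.mem_ofPred_eq, Set.mem_Ioc]
    have := hs.1
    split_ifs <;> first | rfl | (exfalso; grind)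
  -- The closed triangle has sections `[s, t]`, which differ from `(s, t]` by a null set.
  have k2 := key S2 hS2m fun s hs => by
    rw [intervalIntegral.integral_of_le hs.2, hν, ← integral_Icc_eq_integral_Ioc (x := s),
      ← integral_indicator measurableSet_Ioc, ← integral_indicator measurableSet_Icc]
    congr 1
    ext r
    simp only [Set.indicator, hS2, Set.mem_ofPred_eq, Set.mem_Ioc, Set.mem_Icc]
    have := hs.1
    split_ifs <;> first | rfl | (exfalso; grind)
  rw [e1, e2]
  linarith

end SquareIntegral

/-! ### Exponentials of generator matrices -/

section MatrixExp

variable {S : Type*} [Fintype S] [DecidableEq S]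

theorem exp_apply_nonneg_of_nonneg {A : Matrix S S ℝ} (hA : ∀ a b, 0 ≤ A a b) (a b : S) :
    0 ≤ NormedSpace.exp A a b := by
  let _ : NormedRing (Matrix S S ℝ) := Matrix.linftyOpNormedRing
  let _ : NormedAlgebra ℝ (Matrix S S ℝ) := Matrix.linftyOpNormedAlgebra
  have hpow : ∀ (n : ℕ) a b, 0 ≤ (A ^ n) a b := by
    intro n
    induction n with
    | zero => intro a b; simp only [pow_zero, Matrix.one_apply]; split_ifs <;> norm_num
    | succ n ih =>
      intro a b
      rw [pow_succ, Matrix.mul_apply]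
      exact Finset.sum_nonneg fun c _ => mul_nonneg (ih a c) (hA c b)
  have h := NormedSpace.exp_series_hasSum_exp' (𝕂 := ℝ) A
  have h' : HasSum (fun n : ℕ => ((n.factorial : ℝ)⁻¹ • A ^ n) a b) (NormedSpace.exp A a b) :=
    Pi.hasSum.1 (Pi.hasSum.1 h a) b
  exact h'.nonneg fun n => by
    rw [Matrix.smul_apply, smul_eq_mul]
    exact mul_nonneg (by positivity) (hpow n a b)

/-- Uniformization: adding a large multiple of the identity makes every entry nonnegative, and costs
only a positive scalar factor in the exponential. -/
theorem exp_apply_nonneg {Q : Matrix S S ℝ} (hQ : ∀ a b, a ≠ b → 0 ≤ Q a b) {t : ℝ}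
    (ht : 0 ≤ t) (a b : S) : 0 ≤ NormedSpace.exp (t • Q) a b := by
  set c : ℝ := ∑ a, |Q a a| with hc
  have hcomm : Commute (-(t * c) • (1 : Matrix S S ℝ)) (t • (Q + c • 1)) :=
    (Commute.one_left _).smul_left _
  have hsplit : t • Q = -(t * c) • (1 : Matrix S S ℝ) + t • (Q + c • 1) := by
    rw [smul_add, smul_smul]; module
  rw [hsplit, Matrix.exp_add_of_commute _ _ hcomm]
  have h1 : NormedSpace.exp (-(t * c) • (1 : Matrix S S ℝ))
      = Matrix.diagonal fun _ => Real.exp (-(t * c)) := by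
    rw [Matrix.smul_one_eq_diagonal, Matrix.exp_diagonal]
    congr 1
    ext i
    rw [Pi.coe_exp, Real.exp_eq_exp_ℝ]
  rw [h1, Matrix.diagonal_mul]
  refine mul_nonneg (Real.exp_pos _).le (exp_apply_nonneg_of_nonneg (fun x y => ?_) a b)
  rw [Matrix.smul_apply, smul_eq_mul]
  refine mul_nonneg ht ?_
  by_cases hxy : x = y
  · subst hxy
    have : |Q x x| ≤ c := Finset.single_le_sum (f := fun a => |Q a a|)
      (fun i _ => abs_nonneg _) (Finset.mem_univ x)
    simp only [Matrix.add_apply, Matrix.smul_apply, Matrix.one_apply_eq, smul_eq_mul, mul_one]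
    linarith [neg_abs_le (Q x x)]
  · simpa [Matrix.one_apply_ne hxy] using hQ x y hxy

/-- Kolmogorov's equation, with `Q` next to `f`: this order lets the time integral of `Q f` be
computed exactly. -/
theorem hasDerivAt_exp_mulVec (Q : Matrix S S ℝ) (f : S → ℝ) (s r : ℝ) (a : S) :
    HasDerivAt (fun r => (NormedSpace.exp ((r - s) • Q)).mulVec f a)
      ((NormedSpace.exp ((r - s) • Q)).mulVec (Q.mulVec f) a) r := by
  let _ : NormedRing (Matrix S S ℝ) := Matrix.linftyOpNormedRing
  let _ : NormedAlgebra ℝ (Matrix S S ℝ) := Matrix.linftyOpNormedAlgebra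
  have h := (hasDerivAt_exp_smul_const (𝕂 := ℝ) Q (r - s)).scomp r
    ((hasDerivAt_id r).sub_const s)
  rw [one_smul] at h
  have h' : ∀ b, HasDerivAt (fun r => NormedSpace.exp ((r - s) • Q) a b)
      ((NormedSpace.exp ((r - s) • Q) * Q) a b) r := fun b =>
    hasDerivAt_pi.1 (hasDerivAt_pi.1 h a) b
  rw [Matrix.mulVec_mulVec]
  exact HasDerivAt.fun_sum fun b _ => (h' b).mul_const (f b)

end MatrixExp

/-! ### Time integrals along a finite Markov chain -/

section Chain

variable {S : Type*} [Fintype S] [DecidableEq S] [TopologicalSpace S]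
  [MeasurableSpace S] [MeasurableSingletonClass S] {T : ℝ} {Q : Matrix S S ℝ} {μ : Measure S}
  {Ω : Type*} [MeasurableSpace Ω] {P : Measure Ω} {X : ℝ → Ω → S}

/-- The path, frozen outside of `[0, T]`, is jointly measurable in time and chance. -/
theorem IsMarkovChain.measurable_uncurry [DiscreteTopology S] (hX : IsMarkovChain T Q μ P X) (hT : 0 ≤ T)
    (h : S → ℝ) :
    Measurable (Function.uncurry fun s ω => h (X (max 0 (min s T)) ω)) := by
  have hmem : ∀ s : ℝ, max 0 (min s T) ∈ Set.Icc 0 T := fun s =>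
    ⟨le_max_left _ _, max_le hT (min_le_right _ _)⟩
  have hh : Measurable h := measurable_of_finite h
  have hrc : ∀ ω s, ContinuousWithinAt (fun s => h (X (max 0 (min s T)) ω)) (Set.Ici s) s := by
    intro ω s
    have hcont : ContinuousWithinAt (fun s => X (max 0 (min s T)) ω) (Set.Ici s) s := by
      rcases lt_or_ge s T with hs | hs
      · have hlt : max 0 (min s T) < T ∨ max 0 (min s T) = T := lt_or_eq_of_le (hmem s).2
        rcases hlt with hlt | heq
        · refine ContinuousWithinAt.comp (t := Set.Ici (max 0 (min s T)))
            (g := fun u => X u ω) (f := fun s => max 0 (min s T))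
            (hX.right_continuous ω _ ⟨(hmem s).1, hlt⟩) (by fun_prop) ?_
          intro u (hu : s ≤ u)
          exact max_le_max le_rfl (min_le_min hu le_rfl)
        -- The frozen time can equal `T` with `s < T` only when `T = 0`; it then stays at `T`.
        · refine (continuousWithinAt_const (b := X T ω)).congr (fun u (hu : s ≤ u) => ?_) ?_
          · have h1 : max 0 (min s T) ≤ max 0 (min u T) := max_le_max le_rfl (min_le_min hu le_rfl)
            have h2 := (hmem u).2
            rw [show max 0 (min u T) = T by linarith]
          · rw [heq]
      · refine (continuousWithinAt_const (b := X T ω)).congr (fun u (hu : s ≤ u) => ?_) ?_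
        · rw [min_eq_right (hs.trans hu), max_eq_right hT]
        · rw [min_eq_right hs, max_eq_right hT]
    exact (continuous_of_discreteTopology (f := h)).continuousAt.comp_continuousWithinAt hcont
  -- The path is the limit of its values at the next point of the grid of mesh `1/(n+1)`. These
  -- times lie to the right of `s`, so right continuity suffices, and for fixed `n` they take
  -- countably many values.
  refine measurable_of_tendsto_metrizable
    (f := fun (n : ℕ) (p : ℝ × Ω) =>
      h (X (max 0 (min (((⌊p.1 * ((n : ℝ) + 1)⌋ : ℝ) + 1) / ((n : ℝ) + 1)) T)) p.2)) ?_ ?_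
  · intro n
    have hg : Measurable fun q : ℤ × Ω =>
        h (X (max 0 (min (((q.1 : ℝ) + 1) / ((n : ℝ) + 1)) T)) q.2) :=
      measurable_from_prod_countable_right fun k =>
        hh.comp (hX.measurable _ (hmem (((k : ℝ) + 1) / ((n : ℝ) + 1))))
    have hfl : Measurable fun p : ℝ × Ω => ((⌊p.1 * ((n : ℝ) + 1)⌋ : ℤ), p.2) :=
      (Int.measurable_floor.comp (measurable_fst.mul_const _)).prodMk measurable_snd
    exact hg.comp hfl
  · rw [tendsto_pi_nhds]
    rintro ⟨s, ω⟩
    have hlim : Tendsto (fun n : ℕ => ((⌊s * ((n : ℝ) + 1)⌋ : ℝ) + 1) / ((n : ℝ) + 1)) atTop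
        (𝓝[Set.Ici s] s) := by
      refine tendsto_nhdsWithin_iff.2 ⟨?_, Eventually.of_forall fun n => ?_⟩
      · have hup : Tendsto (fun n : ℕ => s + 1 / ((n : ℝ) + 1)) atTop (𝓝 (s + 0)) :=
          tendsto_const_nhds.add tendsto_one_div_add_atTop_nhds_zero_nat
        rw [add_zero] at hup
        refine tendsto_of_tendsto_of_tendsto_of_le_of_le tendsto_const_nhds hup
          (fun n => ?_) (fun n => ?_)
        · rw [le_div_iff₀ (by positivity)]
          exact (Int.lt_floor_add_one _).le
        · have hn : (0 : ℝ) < (n : ℝ) + 1 := by positivity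
          rw [div_le_iff₀ hn, add_mul, div_mul_cancel₀ _ hn.ne']
          linarith [Int.floor_le (s * ((n : ℝ) + 1))]
      · rw [Set.mem_Ici, le_div_iff₀ (by positivity)]
        exact (Int.lt_floor_add_one _).le
    exact (hrc ω s).tendsto.comp hlim

/-- The two-time correlations of a Markov chain. -/
theorem IsMarkovChain.exists_integral_mul_eq [IsProbabilityMeasure P]
    (hX : IsMarkovChain T Q μ P X) (hQ : ∀ a b, a ≠ b → 0 ≤ Q a b) {s : ℝ} (hs : 0 ≤ s)
    (u : S → ℝ) :
    ∃ q : S → ℝ, ∀ v : S → ℝ, ∀ r, s ≤ r → r ≤ T →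
      ∫ ω, u (X s ω) * v (X r ω) ∂P
        = ∑ a, q a * (NormedSpace.exp ((r - s) • Q)).mulVec v a := by
  -- The weight is the law of `X_s` times `u`. It depends neither on `v` nor on `r`, so
  -- differentiation in `r` only affects the exponential.
  refine ⟨fun a => (∑ c, (μ {c}).toReal * NormedSpace.exp ((s - 0) • Q) c a) * u a,
    fun v r hsr hrT => ?_⟩
  have m0 : Measurable (X 0) := hX.measurable 0 ⟨le_rfl, by linarith⟩
  have ms : Measurable (X s) := hX.measurable s ⟨hs, by linarith⟩
  have mr : Measurable (X r) := hX.measurable r ⟨by linarith, hrT⟩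
  set Y : Ω → S × S × S := fun ω => (X 0 ω, X s ω, X r ω) with hY
  have mY : Measurable Y := m0.prodMk (ms.prodMk mr)
  have hlaw : ∀ c a b, (P.map Y).real {(c, a, b)}
      = (μ {c}).toReal * (NormedSpace.exp ((s - 0) • Q) c a
          * NormedSpace.exp ((r - s) • Q) a b) := by
    intro c a b
    have hfd := hX.finite_dim 2 ![0, s, r] ![c, a, b] (by simp)
      (by
        intro i j hij
        fin_cases i <;> fin_cases j <;> simp at hij ⊢ <;> linarith)
      (by simpa [Fin.last] using hrT)
    rw [Measure.real, Measure.map_apply mY (measurableSet_singleton _)]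
    have hset : Y ⁻¹' {(c, a, b)} = {ω | ∀ i, X (![0, s, r] i) ω = ![c, a, b] i} := by
      ext ω
      simp [hY, Fin.forall_fin_succ]
    rw [hset, hfd]
    simp only [Fin.prod_univ_two, ENNReal.toReal_mul]
    simp only [Matrix.cons_val_zero]
    congr 2
    · exact ENNReal.toReal_ofReal (exp_apply_nonneg hQ (by simpa using hs) _ _)
    · exact ENNReal.toReal_ofReal (exp_apply_nonneg hQ (by simpa using hsr) _ _)
  have : IsProbabilityMeasure (P.map Y) := Measure.isProbabilityMeasure_map mY.aemeasurable
  have e := integral_map (μ := P) mY.aemeasurable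
    (f := fun y : S × S × S => u y.2.1 * v y.2.2) (measurable_of_finite _).aestronglyMeasurable
  simp only [hY] at e
  rw [← e, integral_fintype Integrable.of_finite, Fintype.sum_prod_type]
  simp only [Fintype.sum_prod_type, smul_eq_mul]
  simp only [← hY, hlaw]
  rw [Finset.sum_comm]
  refine Finset.sum_congr rfl fun a _ => ?_
  simp only [Matrix.mulVec, dotProduct, Finset.sum_mul, Finset.mul_sum]
  rw [Finset.sum_comm]
  refine Finset.sum_congr rfl fun c _ => Finset.sum_congr rfl fun b _ => ?_
  ring

/-- The second moment of `∫ (Q f)(X_s) ds` is small when `f` is small and `Q f` is bounded. -/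
theorem IsMarkovChain.integral_sq_mulVec_le [DiscreteTopology S] [IsProbabilityMeasure P]
    (hX : IsMarkovChain T Q μ P X) (hQ : ∀ a b, a ≠ b → 0 ≤ Q a b) (f : S → ℝ) {w F : ℝ}
    (hw : ∀ a, |Q.mulVec f a| ≤ w) (hF : ∀ a, |f a| ≤ F) {t : ℝ} (ht : t ∈ Set.Icc 0 T) :
    ∫ ω, (∫ s in (0 : ℝ)..t, Q.mulVec f (X (max 0 (min s T)) ω)) ^ 2 ∂P
      ≤ 2 * t * (2 * w * F) := by
  refine integral_sq_timeIntegral_le P (fun s ω => Q.mulVec f (X (max 0 (min s T)) ω))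
    (hX.measurable_uncurry (ht.1.trans ht.2) _) (fun s ω => hw _) ht.1 fun s hs => ?_
  have hclip : ∀ r ∈ Set.Icc s t, max 0 (min r T) = r := fun r hr => by
    rw [min_eq_left (hr.2.trans ht.2), max_eq_right (hs.1.trans hr.1)]
  obtain ⟨q, hq⟩ := hX.exists_integral_mul_eq hQ hs.1 (Q.mulVec f)
  have hderiv : ∀ r, HasDerivAt
      (fun r => ∑ a, q a * (NormedSpace.exp ((r - s) • Q)).mulVec f a)
      (∑ a, q a * (NormedSpace.exp ((r - s) • Q)).mulVec (Q.mulVec f) a) r := fun r =>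
    HasDerivAt.fun_sum fun a _ => (hasDerivAt_exp_mulVec Q f s r a).const_mul (q a)
  have hcont : Continuous fun r =>
      ∑ a, q a * (NormedSpace.exp ((r - s) • Q)).mulVec (Q.mulVec f) a :=
    continuous_finsetSum _ fun a _ => continuous_const.mul
      (continuous_iff_continuousAt.2 fun r =>
        (hasDerivAt_exp_mulVec Q (Q.mulVec f) s r a).continuousAt)
  -- The correlation of `Qf(X_s)` with `Qf(X_r)` is the `r`-derivative of its correlation with
  -- `f(X_r)`, so only the two endpoints remain.
  have e : ∫ r in s..t, ∫ ω, Q.mulVec f (X (max 0 (min s T)) ω)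
        * Q.mulVec f (X (max 0 (min r T)) ω) ∂P
      = ∫ ω, Q.mulVec f (X s ω) * f (X t ω) ∂P - ∫ ω, Q.mulVec f (X s ω) * f (X s ω) ∂P := by
    rw [hq f t hs.2 ht.2, hq f s le_rfl (hs.2.trans ht.2),
      ← intervalIntegral.integral_eq_sub_of_hasDerivAt (fun r _ => hderiv r)
        (hcont.intervalIntegrable _ _)]
    refine intervalIntegral.integral_congr fun r hr => ?_
    rw [Set.uIcc_of_le hs.2] at hr
    rw [hclip s ⟨le_rfl, hs.2⟩, hclip r hr]
    exact hq _ r hr.1 (hr.2.trans ht.2)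
  have hb : ∀ r, |∫ ω, Q.mulVec f (X s ω) * f (X r ω) ∂P| ≤ w * F := fun r => by
    have := norm_integral_le_of_norm_le_const (μ := P) (C := w * F)
      (f := fun ω => Q.mulVec f (X s ω) * f (X r ω))
      (Eventually.of_forall fun ω => by
        rw [Real.norm_eq_abs, abs_mul]
        exact mul_le_mul (hw _) (hF _) (abs_nonneg _) ((abs_nonneg _).trans (hw (X s ω))))
    simpa using this
  rw [e]
  refine (abs_sub _ _).trans ?_
  linarith [hb t, hb s]

/-- A function that is, up to a small error, the image of a small function under the generator
has a small time integral along the chain. -/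
theorem IsMarkovChain.lintegral_abs_timeIntegral_le [DiscreteTopology S]
    [IsProbabilityMeasure P]
    (hX : IsMarkovChain T Q μ P X) (hQ : ∀ a b, a ≠ b → 0 ≤ Q a b) (f V : S → ℝ) {w F e : ℝ}
    (hw : ∀ a, |Q.mulVec f a| ≤ w) (hF : ∀ a, |f a| ≤ F)
    (he : ∀ a, |V a - Q.mulVec f a| ≤ e) {t : ℝ} (ht : t ∈ Set.Icc 0 T) :
    ∫⁻ ω, ENNReal.ofReal |∫ s in (0 : ℝ)..t, V (X s ω)| ∂P
      ≤ ENNReal.ofReal (√(2 * t * (2 * w * F)) + t * e) := by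
  have hT : 0 ≤ T := ht.1.trans ht.2
  set A : Ω → ℝ := fun ω => ∫ s in (0 : ℝ)..t, Q.mulVec f (X (max 0 (min s T)) ω) with hA
  have hmeas := fun h : S → ℝ => hX.measurable_uncurry hT h
  have hAm : StronglyMeasurable A := by
    simp only [hA, intervalIntegral.integral_of_le ht.1]
    exact ((hmeas (Q.mulVec f)).comp measurable_swap).stronglyMeasurable.integral_prod_right'
      (ν := volume.restrict (Set.Ioc 0 t))
  have hbd : ∀ h : S → ℝ, ∃ C, ∀ a, |h a| ≤ C := fun h =>
    ⟨∑ a, |h a|, fun a => Finset.single_le_sum (f := fun a => |h a|)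
      (fun i _ => abs_nonneg _) (Finset.mem_univ a)⟩
  have hii : ∀ (h : S → ℝ) ω, IntervalIntegrable (fun s => h (X (max 0 (min s T)) ω)) volume 0 t :=
    fun h ω => by
      obtain ⟨C, hC⟩ := hbd h
      rw [intervalIntegrable_iff_integrableOn_Ioc_of_le ht.1, IntegrableOn]
      exact Integrable.of_bound
        ((hmeas h).comp (measurable_id.prodMk measurable_const)).aestronglyMeasurable C
        (Eventually.of_forall fun s => hC _)
  have hpt : ∀ ω, |∫ s in (0 : ℝ)..t, V (X s ω)| ≤ |A ω| + t * e := by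
    intro ω
    have h1 : ∫ s in (0 : ℝ)..t, V (X s ω) = ∫ s in (0 : ℝ)..t, V (X (max 0 (min s T)) ω) := by
      refine intervalIntegral.integral_congr fun r hr => ?_
      rw [Set.uIcc_of_le ht.1] at hr
      rw [min_eq_left (hr.2.trans ht.2), max_eq_right hr.1]
    have h2 : ∫ s in (0 : ℝ)..t, V (X (max 0 (min s T)) ω)
        = A ω + ∫ s in (0 : ℝ)..t,
          (V (X (max 0 (min s T)) ω) - Q.mulVec f (X (max 0 (min s T)) ω)) := by
      rw [intervalIntegral.integral_sub (hii V ω) (hii _ ω)]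
      ring
    have h3 := intervalIntegral.norm_integral_le_of_norm_le_const (a := (0 : ℝ)) (b := t) (C := e)
      (f := fun s => V (X (max 0 (min s T)) ω) - Q.mulVec f (X (max 0 (min s T)) ω))
      (fun s _ => he _)
    rw [sub_zero, abs_of_nonneg ht.1, Real.norm_eq_abs] at h3
    rw [h1, h2]
    refine (abs_add_le _ _).trans ?_
    linarith
  obtain ⟨C, hC⟩ : ∃ C, ∀ ω, |A ω| ≤ C := ⟨w * |t - 0|, fun ω =>
    intervalIntegral.norm_integral_le_of_norm_le_const
      (f := fun s => Q.mulVec f (X (max 0 (min s T)) ω)) fun s _ => hw _⟩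
  have hA2 : MemLp A 2 P := MemLp.of_bound hAm.aestronglyMeasurable C (Eventually.of_forall hC)
  have hA2' : MemLp (fun ω => |A ω|) 2 P := hA2.abs
  have hAabs : ∫ ω, |A ω| ∂P ≤ √(2 * t * (2 * w * F)) := by
    refine Real.le_sqrt_of_sq_le ?_
    refine le_trans ?_ (hX.integral_sq_mulVec_le hQ f hw hF ht)
    -- Nonnegativity of the variance of `|A|` gives `(E|A|)² ≤ E[A²]`.
    have hv := ProbabilityTheory.variance_nonneg (fun ω => |A ω|) P
    rw [ProbabilityTheory.variance_eq_sub hA2'] at hv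
    simpa using hv
  have hint : Integrable (fun ω => |A ω| + t * e) P :=
    (hA2'.integrable (by norm_num)).add (integrable_const _)
  calc ∫⁻ ω, ENNReal.ofReal |∫ s in (0 : ℝ)..t, V (X s ω)| ∂P
      ≤ ∫⁻ ω, ENNReal.ofReal (|A ω| + t * e) ∂P :=
        lintegral_mono fun ω => ENNReal.ofReal_le_ofReal (hpt ω)
    _ = ENNReal.ofReal (∫ ω, (|A ω| + t * e) ∂P) :=
        (ofReal_integral_eq_lintegral_ofReal hint
          (Eventually.of_forall fun ω => (abs_nonneg _).trans (hpt ω))).symm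
    _ ≤ _ := by
        refine ENNReal.ofReal_le_ofReal ?_
        rw [integral_add (hA2'.integrable (by norm_num)) (integrable_const _)]
        simpa using hAabs

end Chain

/-! ### The generator of SEP(α) on linear functions -/

section Generator

variable {α N : ℕ}

theorem occ_le (η : Config α N) (x : ℕ) : occ η x ≤ α := by
  unfold occ
  split_ifs with h
  · exact Nat.lt_succ_iff.1 (η ⟨x, h⟩).2
  · exact Nat.zero_le _

theorem abs_occ_sub_occ_le (η : Config α N) (x y : ℕ) :
    |(occ η x : ℝ) - occ η y| ≤ α := by
  have h1 : (occ η x : ℝ) ≤ α := by exact_mod_cast occ_le η x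
  have h2 : (occ η y : ℝ) ≤ α := by exact_mod_cast occ_le η y
  exact abs_sub_le_of_nonneg_of_le (Nat.cast_nonneg _) h1 (Nat.cast_nonneg _) h2

theorem sub_occ_nonneg (η : Config α N) (x : ℕ) : 0 ≤ (α : ℝ) - occ η x :=
  sub_nonneg.2 (by exact_mod_cast occ_le η x)

theorem jumpRate_nonneg (η : Config α N) (x y : ℕ) : 0 ≤ jumpRate η x y :=
  mul_nonneg (Nat.cast_nonneg _) (sub_occ_nonneg η y)

theorem occ_remove (η : Config α N) (x z : ℕ) :
    occ (remove η x) z = if z = x then occ η z - 1 else occ η z := by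
  unfold occ remove
  split_ifs <;> simp_all

theorem occ_inject (η : Config α N) {x : ℕ} (hx : x ∈ Finset.Icc 1 (N - 1)) (z : ℕ) :
    occ (inject η x) z = if z = x then min (occ η z + 1) α else occ η z := by
  unfold occ inject
  split_ifs <;> simp_all

theorem inject_of_notMem (η : Config α N) {x : ℕ} (hx : x ∉ Finset.Icc 1 (N - 1)) :
    inject η x = η := by
  ext z
  have : (z : ℕ) ≠ x := fun h => hx (h ▸ z.2)
  simp [inject, this]

/-- The matrix of the generator acts as the generator. -/
theorem generatorMatrix_mulVec (ε γ β δ θ : ℝ) (f : Config α N → ℝ) (η : Config α N) :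
    (generatorMatrix α N ε γ β δ θ).mulVec f η = generator ε γ β δ θ f η := by
  have key : ∀ (c : ℝ) (a : Config α N),
      ∑ ξ, c * ((Pi.single ξ 1 : Config α N → ℝ) a - (Pi.single ξ 1 : Config α N → ℝ) η) * f ξ
        = c * (f a - f η) := by
    intro c a
    simp [mul_assoc, sub_mul, ← Finset.mul_sum, Finset.sum_sub_distrib, Pi.single_apply]
  simp only [Matrix.mulVec, dotProduct, generatorMatrix, Matrix.of_apply, generator,
    leftGenerator, bulkGenerator, rightGenerator, add_mul, Finset.sum_mul,
    Finset.sum_add_distrib]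
  rw [Finset.sum_comm, Finset.sum_comm (s := Finset.univ) (t := Finset.Icc 1 (N - 2))]
  simp only [key]

theorem generatorMatrix_nonneg {ε γ β δ : ℝ} (hε : 0 ≤ ε) (hγ : 0 ≤ γ) (hβ : 0 ≤ β)
    (hδ : 0 ≤ δ) (θ : ℝ) (η ξ : Config α N) (h : η ≠ ξ) :
    0 ≤ generatorMatrix α N ε γ β δ θ η ξ := by
  have key : ∀ (c : ℝ) (a : Config α N), 0 ≤ c →
      0 ≤ c * ((Pi.single ξ 1 : Config α N → ℝ) a - (Pi.single ξ 1 : Config α N → ℝ) η) := by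
    intro c a hc
    rw [Pi.single_eq_of_ne h, sub_zero, Pi.single_apply]
    split_ifs <;> simp [hc]
  have hN : 0 ≤ 1 / (N : ℝ) ^ θ := by positivity
  have hocc : ∀ x, 0 ≤ (occ η x : ℝ) := fun x => Nat.cast_nonneg _
  simp only [generatorMatrix, Matrix.of_apply, generator, leftGenerator, bulkGenerator,
    rightGenerator]
  refine add_nonneg (add_nonneg (add_nonneg ?_ ?_) (Finset.sum_nonneg fun x _ => ?_))
    (add_nonneg ?_ ?_)
  · exact key _ _ (mul_nonneg hN (mul_nonneg hγ (hocc _)))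
  · exact key _ _ (mul_nonneg hN (mul_nonneg hε (sub_occ_nonneg η _)))
  · exact add_nonneg (key _ _ (jumpRate_nonneg _ _ _)) (key _ _ (jumpRate_nonneg _ _ _))
  · exact key _ _ (mul_nonneg hN (mul_nonneg hβ (hocc _)))
  · exact key _ _ (mul_nonneg hN (mul_nonneg hδ (sub_occ_nonneg η _)))

/-- The linear function `η ↦ ∑ φ(x) η(x)`. -/
def linearStatistic (φ : ℕ → ℝ) (η : Config α N) : ℝ :=
  ∑ x ∈ Finset.Icc 1 (N - 1), φ x * (occ η x : ℝ)

theorem linearStatistic_remove (φ : ℕ → ℝ) (η : Config α N) {x : ℕ}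
    (hx : x ∈ Finset.Icc 1 (N - 1)) (h : 0 < occ η x) :
    linearStatistic φ (remove η x) = linearStatistic φ η - φ x := by
  have : ∀ z ∈ Finset.Icc 1 (N - 1), φ z * (occ (remove η x) z : ℝ)
      = φ z * (occ η z : ℝ) - if z = x then φ z else 0 := by
    intro z _
    rw [occ_remove]
    split_ifs with hz
    · subst hz
      rw [Nat.cast_pred h]; ring
    · ring
  rw [linearStatistic, Finset.sum_congr rfl this, Finset.sum_sub_distrib, Finset.sum_ite_eq',
    if_pos hx, linearStatistic]

theorem linearStatistic_inject (φ : ℕ → ℝ) (η : Config α N) {x : ℕ}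
    (hx : x ∈ Finset.Icc 1 (N - 1)) (h : occ η x < α) :
    linearStatistic φ (inject η x) = linearStatistic φ η + φ x := by
  have : ∀ z ∈ Finset.Icc 1 (N - 1), φ z * (occ (inject η x) z : ℝ)
      = φ z * (occ η z : ℝ) + if z = x then φ z else 0 := by
    intro z _
    rw [occ_inject η hx]
    split_ifs with hz
    · subst hz
      rw [min_eq_left h]; push_cast; ring
    · ring
  rw [linearStatistic, Finset.sum_congr rfl this, Finset.sum_add_distrib, Finset.sum_ite_eq',
    if_pos hx, linearStatistic]

theorem linearStatistic_remove_of_eq_zero (φ : ℕ → ℝ) (η : Config α N) {x : ℕ} (h : φ x = 0) :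
    linearStatistic φ (remove η x) = linearStatistic φ η := by
  refine Finset.sum_congr rfl fun z _ => ?_
  rw [occ_remove]
  split_ifs with hz
  · rw [hz, h, zero_mul, zero_mul]
  · rfl

theorem linearStatistic_inject_of_eq_zero (φ : ℕ → ℝ) (η : Config α N) {x : ℕ} (h : φ x = 0) :
    linearStatistic φ (inject η x) = linearStatistic φ η := by
  by_cases hx : x ∈ Finset.Icc 1 (N - 1)
  · refine Finset.sum_congr rfl fun z _ => ?_
    rw [occ_inject η hx]
    split_ifs with hz
    · rw [hz, h, zero_mul, zero_mul]
    · rfl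
  · rw [inject_of_notMem η hx]

/-- The truncations in `inject` and `remove` act only when `x` is empty or `y` is full, and there
the rate vanishes. -/
theorem jumpRate_mul_linearStatistic_move (φ : ℕ → ℝ) (η : Config α N) {x y : ℕ}
    (hx : x ∈ Finset.Icc 1 (N - 1)) (hy : y ∈ Finset.Icc 1 (N - 1)) (hxy : x ≠ y) :
    jumpRate η x y * (linearStatistic φ (move η x y) - linearStatistic φ η)
      = jumpRate η x y * (φ y - φ x) := by
  rcases Nat.eq_zero_or_pos (occ η x) with h0 | h0
  · simp [jumpRate, h0]
  rcases (occ_le η y).eq_or_lt with h1 | h1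
  · simp [jumpRate, h1]
  have h2 : occ (remove η x) y < α := by rwa [occ_remove, if_neg hxy.symm]
  rw [move, linearStatistic_inject φ _ hy h2, linearStatistic_remove φ η hx h0]
  ring

/-- The generator maps linear functions that vanish next to the reservoirs to gradients. -/
theorem generator_linearStatistic (ε γ β δ θ : ℝ) (φ : ℕ → ℝ) (h1 : φ 1 = 0)
    (hN : φ (N - 1) = 0) (η : Config α N) :
    generator ε γ β δ θ (linearStatistic φ) η
      = ∑ x ∈ Finset.Icc 1 (N - 2),
        α * (φ (x + 1) - φ x) * ((occ η x : ℝ) - occ η (x + 1)) := by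
  have hl : leftGenerator ε γ θ (linearStatistic φ) η = 0 := by
    rw [leftGenerator, linearStatistic_remove_of_eq_zero φ η h1,
      linearStatistic_inject_of_eq_zero φ η h1]
    ring
  have hr : rightGenerator β δ θ (linearStatistic φ) η = 0 := by
    rw [rightGenerator, linearStatistic_remove_of_eq_zero φ η hN,
      linearStatistic_inject_of_eq_zero φ η hN]
    ring
  rw [generator, hl, hr, zero_add, add_zero, bulkGenerator]
  refine Finset.sum_congr rfl fun x hx => ?_
  rw [Finset.mem_Icc] at hx
  have hx1 : x ∈ Finset.Icc 1 (N - 1) := Finset.mem_Icc.2 (by omega)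
  have hx2 : x + 1 ∈ Finset.Icc 1 (N - 1) := Finset.mem_Icc.2 (by omega)
  -- Gradient property: `η(x)(α - η(x+1)) - η(x+1)(α - η(x)) = α(η(x) - η(x+1))`.
  rw [jumpRate_mul_linearStatistic_move φ η hx1 hx2 (by omega),
    jumpRate_mul_linearStatistic_move φ η hx2 hx1 (by omega), jumpRate, jumpRate]
  ring

/-- The gradient `∑ g(x) (η(x) - η(x+1))` is, up to a boundary term, in the image of the
generator. -/
theorem exists_generator_eq (hα : 1 ≤ α) (hN : 3 ≤ N) (ε γ β δ θ : ℝ) (g : ℕ → ℝ) {L : ℝ}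
    (hg : ∑ x ∈ Finset.Icc 1 (N - 2), |g x| ≤ L) :
    ∃ (f : Config α N → ℝ) (c : ℝ), |c| ≤ L / (N - 2 : ℕ) ∧
      (∀ η, |f η| ≤ (N - 1 : ℕ) * (2 * L)) ∧
      ∀ η, generator ε γ β δ θ f η
        = ∑ x ∈ Finset.Icc 1 (N - 2), g x * ((occ η x : ℝ) - occ η (x + 1))
          - c * ((occ η 1 : ℝ) - occ η (N - 1)) := by
  have hα0 : (0 : ℝ) < α := by exact_mod_cast hα
  have hn : (0 : ℝ) < (N - 2 : ℕ) := by exact_mod_cast (by omega : 0 < N - 2)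
  -- `c` is the mean of `g` over the `N - 2` bonds, which forces the primitive `φ` of `(g - c)/α` to
  -- vanish at `N - 1` as well as at `1`.
  set c : ℝ := (∑ x ∈ Finset.Icc 1 (N - 2), g x) / (N - 2 : ℕ) with hc
  have hcL : |c| ≤ L / (N - 2 : ℕ) := by
    rw [hc, abs_div, abs_of_pos hn]
    gcongr
    exact (Finset.abs_sum_le_sum_abs _ _).trans hg
  set φ : ℕ → ℝ := fun x => ∑ z ∈ Finset.Ico 1 x, (g z - c) / α with hφ
  have hIco : Finset.Ico 1 (N - 1) = Finset.Icc 1 (N - 2) := by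
    ext x; simp only [Finset.mem_Ico, Finset.mem_Icc]; omega
  have hφ1 : φ 1 = 0 := by simp [hφ]
  have hφN : φ (N - 1) = 0 := by
    simp only [hφ, hIco]
    rw [← Finset.sum_div, Finset.sum_sub_distrib, Finset.sum_const, Nat.card_Icc, nsmul_eq_mul,
      Nat.add_sub_cancel, hc, mul_div_cancel₀ _ hn.ne', sub_self, zero_div]
  have hφb : ∀ x ∈ Finset.Icc 1 (N - 1), |φ x| ≤ 2 * L / α := by
    intro x hx
    rw [Finset.mem_Icc] at hx
    calc |φ x| ≤ ∑ z ∈ Finset.Ico 1 x, |(g z - c) / α| := Finset.abs_sum_le_sum_abs _ _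
      _ ≤ ∑ z ∈ Finset.Icc 1 (N - 2), |(g z - c) / α| := by
          refine Finset.sum_le_sum_of_subset_of_nonneg (fun z hz => ?_) fun _ _ _ => abs_nonneg _
          rw [Finset.mem_Ico] at hz
          exact Finset.mem_Icc.2 (by omega)
      _ ≤ ∑ z ∈ Finset.Icc 1 (N - 2), (|g z| + |c|) / α := by
          refine Finset.sum_le_sum fun z _ => ?_
          rw [abs_div, abs_of_pos hα0]
          gcongr
          exact abs_sub _ _
      _ ≤ 2 * L / α := by
          rw [← Finset.sum_div, Finset.sum_add_distrib, Finset.sum_const, Nat.card_Icc,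
            nsmul_eq_mul, Nat.add_sub_cancel]
          have : ((N - 2 : ℕ) : ℝ) * |c| ≤ L := by
            rw [le_div_iff₀ hn] at hcL
            linarith
          gcongr
          linarith
  refine ⟨linearStatistic φ, c, hcL, fun η => ?_, fun η => ?_⟩
  · calc |linearStatistic φ η| ≤ ∑ x ∈ Finset.Icc 1 (N - 1), |φ x * (occ η x : ℝ)| :=
          Finset.abs_sum_le_sum_abs _ _
      _ ≤ ∑ x ∈ Finset.Icc 1 (N - 1), 2 * L := by
          refine Finset.sum_le_sum fun x hx => ?_
          have ho : (occ η x : ℝ) ≤ α := by exact_mod_cast occ_le η x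
          rw [abs_mul, Nat.abs_cast]
          calc |φ x| * (occ η x : ℝ) ≤ 2 * L / α * α :=
                mul_le_mul (hφb x hx) ho (Nat.cast_nonneg _) ((abs_nonneg _).trans (hφb x hx))
            _ = 2 * L := div_mul_cancel₀ _ hα0.ne'
      _ = (N - 1 : ℕ) * (2 * L) := by
          rw [Finset.sum_const, Nat.card_Icc, nsmul_eq_mul, Nat.add_sub_cancel]
  · rw [generator_linearStatistic ε γ β δ θ φ hφ1 hφN η]
    have htel : ∑ x ∈ Finset.Icc 1 (N - 2), ((occ η x : ℝ) - occ η (x + 1))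
        = (occ η 1 : ℝ) - occ η (N - 1) := by
      rw [← hIco]
      have := Finset.sum_Ico_sub (fun x => (occ η x : ℝ)) (show 1 ≤ N - 1 by omega)
      rw [← neg_inj, ← Finset.sum_neg_distrib]
      simpa using this
    rw [← htel, Finset.mul_sum, ← Finset.sum_sub_distrib]
    refine Finset.sum_congr rfl fun x hx => ?_
    have hs : φ (x + 1) = φ x + (g x - c) / α :=
      Finset.sum_Ico_succ_top (Finset.mem_Icc.1 hx).1 _
    rw [hs]
    field_simp
    ring

end Generator

/-! ### The replacement estimate -/

section Replacement

variable {α N : ℕ}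

/-- Time integrals of gradients of bounded mass are small along the accelerated process. -/
theorem IsAcceleratedSEP.lintegral_abs_timeIntegral_le (hα : 1 ≤ α) (hN : 3 ≤ N)
    {ε γ β δ θ T : ℝ} (hε : 0 ≤ ε) (hγ : 0 ≤ γ) (hβ : 0 ≤ β) (hδ : 0 ≤ δ)
    {μ : Measure (Config α N)} {Ω : Type*} [MeasurableSpace Ω] {P : Measure Ω}
    [IsProbabilityMeasure P] {X : ℝ → Ω → Config α N}
    (hX : IsAcceleratedSEP α N ε γ β δ θ T μ P X) {t : ℝ} (ht : t ∈ Set.Icc 0 T)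
    (g : ℕ → ℝ) {L : ℝ} (hg : ∑ x ∈ Finset.Icc 1 (N - 2), |g x| ≤ L) (hL : L ≤ (N - 2 : ℕ))
    (V : Config α N → ℝ) (hV : ∀ η, |V η| ≤ α)
    (hVg : ∀ η, V η = ∑ x ∈ Finset.Icc 1 (N - 2), g x * ((occ η x : ℝ) - occ η (x + 1))) :
    ∫⁻ ω, ENNReal.ofReal |∫ s in (0 : ℝ)..t, V (X s ω)| ∂P
      ≤ ENNReal.ofReal (√(2 * t * (2 * (2 * α) * ((N - 1 : ℕ) * (2 * L) / (N : ℝ) ^ 2)))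
        + t * (L / (N - 2 : ℕ) * α)) := by
  obtain ⟨f, c, hc, hf, hgen⟩ := exists_generator_eq (α := α) hα hN ε γ β δ θ g hg
  have hN2 : (0 : ℝ) < (N : ℝ) ^ 2 := by
    have : 0 < N := by omega
    positivity
  have hn : (0 : ℝ) < (N - 2 : ℕ) := by exact_mod_cast (by omega : 0 < N - 2)
  -- Dividing `f` by `N²` absorbs the acceleration, and is what makes the test function small.
  have hQf : ∀ η, (((N : ℝ) ^ 2) • generatorMatrix α N ε γ β δ θ).mulVec
      (((N : ℝ) ^ 2)⁻¹ • f) η = V η - c * ((occ η 1 : ℝ) - occ η (N - 1)) := by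
    intro η
    rw [Matrix.smul_mulVec, Matrix.mulVec_smul, smul_smul, mul_inv_cancel₀ hN2.ne', one_smul,
      generatorMatrix_mulVec, hgen, hVg]
  have hcb : ∀ η : Config α N,
      |c * ((occ η 1 : ℝ) - occ η (N - 1))| ≤ L / (N - 2 : ℕ) * α := fun η => by
    rw [abs_mul]
    exact mul_le_mul hc (abs_occ_sub_occ_le η _ _) (abs_nonneg _) ((abs_nonneg _).trans hc)
  refine IsMarkovChain.lintegral_abs_timeIntegral_le hX (fun a b hab => ?_)
    (((N : ℝ) ^ 2)⁻¹ • f) V (fun η => ?_) (fun η => ?_) (fun η => ?_) ht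
  · rw [Matrix.smul_apply, smul_eq_mul]
    exact mul_nonneg hN2.le (generatorMatrix_nonneg hε hγ hβ hδ θ a b hab)
  · rw [hQf]
    refine (abs_sub _ _).trans ?_
    -- `L ≤ N - 2` bounds the boundary term by `α`, whence the constant `2α` for the image of `f`.
    have h1 : L / (N - 2 : ℕ) * α ≤ α := by
      have : L / (N - 2 : ℕ) ≤ 1 := (div_le_one hn).2 hL
      exact mul_le_of_le_one_left (Nat.cast_nonneg _) this
    linarith [hcb η, hV η]
  · rw [Pi.smul_apply, smul_eq_mul, abs_mul, abs_of_pos (inv_pos.2 hN2), div_eq_inv_mul]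
    exact mul_le_mul_of_nonneg_left (hf η) (inv_pos.2 hN2).le
  · rw [hQf, sub_sub_cancel]
    exact hcb η

/-- Summation by parts: `a 0 - a (y + 1)` telescopes, and the increment at `x` is used by the `L -
x` indices `y ≥ x`. -/
theorem sum_range_mul_sub (a : ℕ → ℝ) (L : ℕ) :
    ∑ x ∈ Finset.range L, ((L : ℝ) - x) * (a x - a (x + 1))
      = L * a 0 - ∑ y ∈ Finset.range L, a (y + 1) := by
  induction L with
  | zero => simp
  | succ L ih =>
    have h : ∀ x, (((L + 1 : ℕ) : ℝ) - x) * (a x - a (x + 1))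
        = ((L : ℝ) - x) * (a x - a (x + 1)) + (a x - a (x + 1)) := fun x => by
      push_cast; ring
    simp only [h, Finset.sum_add_distrib]
    rw [Finset.sum_range_succ, ih, Finset.sum_range_sub', Finset.sum_range_succ]
    push_cast
    ring

theorem abs_sub_average_le (η : Config α N) (x L : ℕ) (hL : 1 ≤ L) (s : Finset ℕ)
    (hs : s.card ≤ L) :
    |(occ η x : ℝ) - 1 / (L : ℝ) * ∑ y ∈ s, (occ η y : ℝ)| ≤ α := by
  have hL0 : (0 : ℝ) < L := by exact_mod_cast hL
  have h1 : (occ η x : ℝ) ≤ α := by exact_mod_cast occ_le η x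
  have h2 : ∑ y ∈ s, (occ η y : ℝ) ≤ L * α := by
    calc ∑ y ∈ s, (occ η y : ℝ) ≤ s.card • (α : ℝ) :=
          Finset.sum_le_card_nsmul _ _ _ fun y _ => by exact_mod_cast occ_le η y
      _ ≤ L * α := by rw [nsmul_eq_mul]; gcongr
  refine abs_sub_le_of_nonneg_of_le (Nat.cast_nonneg _) h1 (by positivity) ?_
  rw [one_div, inv_mul_le_iff₀ hL0]
  exact h2

/-- The discrepancy with the average to the right, as a gradient. -/
theorem exists_rightAverage_eq {L : ℕ} (hL : 1 ≤ L) (hLN : L + 2 ≤ N) :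
    ∃ g : ℕ → ℝ, ∑ x ∈ Finset.Icc 1 (N - 2), |g x| ≤ L ∧
      ∀ η : Config α N, (occ η 1 : ℝ) - rightAverage η L 1
        = ∑ x ∈ Finset.Icc 1 (N - 2), g x * ((occ η x : ℝ) - occ η (x + 1)) := by
  have hL0 : (0 : ℝ) < L := by exact_mod_cast hL
  have hfil : (Finset.Icc 1 (N - 2)).filter (fun x => x ≤ L) = Finset.Ico (0 + 1) (L + 1) := by
    ext x; simp only [Finset.mem_filter, Finset.mem_Icc, Finset.mem_Ico]; omega
  -- The bond `(x, x+1)` is crossed on the way from `1` to each of the `L + 1 - x` sites `x+1, …,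
  -- L+1` of the average.
  refine ⟨fun x => if x ≤ L then ((L : ℝ) + 1 - x) / L else 0, ?_, fun η => ?_⟩
  · simp only [apply_ite abs, abs_zero, ← Finset.sum_filter, hfil]
    refine (Finset.sum_le_card_nsmul _ _ 1 fun x hx => ?_).trans (by simp)
    rw [Finset.mem_Ico] at hx
    have h1 : (1 : ℝ) ≤ x := by exact_mod_cast hx.1
    have h2 : (x : ℝ) ≤ L := by exact_mod_cast Nat.lt_succ_iff.1 hx.2
    rw [abs_of_nonneg (div_nonneg (by linarith) hL0.le), div_le_one hL0]
    linarith
  · simp only [ite_mul, zero_mul, ← Finset.sum_filter, hfil]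
    rw [← Finset.sum_Ico_add', ← Finset.range_eq_Ico]
    have h := sum_range_mul_sub (fun x => (occ η (x + 1) : ℝ)) L
    have hI : Finset.Icc (1 + 1) (1 + L) = Finset.Ico (0 + 2) (L + 2) := by
      ext x; simp only [Finset.mem_Icc, Finset.mem_Ico]; omega
    rw [rightAverage, hI, ← Finset.sum_Ico_add', ← Finset.range_eq_Ico]
    have e : ∀ x : ℕ, ((L : ℝ) + 1 - ((x + 1 : ℕ) : ℝ)) / L
          * ((occ η (x + 1) : ℝ) - occ η (x + 1 + 1))
        = 1 / L * (((L : ℝ) - x) * ((occ η (x + 1) : ℝ) - occ η (x + 1 + 1))) := fun x => by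
      push_cast; ring
    simp only [e]
    rw [← Finset.mul_sum, h]
    field_simp

/-- The discrepancy with the average to the left, as a gradient. -/
theorem exists_leftAverage_eq {L : ℕ} (hL : 1 ≤ L) (hLN : L + 2 ≤ N) :
    ∃ g : ℕ → ℝ, ∑ x ∈ Finset.Icc 1 (N - 2), |g x| ≤ L ∧
      ∀ η : Config α N, (occ η (N - 1) : ℝ) - leftAverage η L (N - 1)
        = ∑ x ∈ Finset.Icc 1 (N - 2), g x * ((occ η x : ℝ) - occ η (x + 1)) := by
  have hL0 : (0 : ℝ) < L := by exact_mod_cast hL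
  have hfil : (Finset.Icc 1 (N - 2)).filter (fun x => N - 1 - L ≤ x)
      = Finset.Ico (N - 1 - L) (N - 1) := by
    ext x; simp only [Finset.mem_filter, Finset.mem_Icc, Finset.mem_Ico]; omega
  have hsum : ∀ F : ℕ → ℝ, ∑ x ∈ Finset.Ico (N - 1 - L) (N - 1), F x
      = ∑ x ∈ Finset.range L, F (N - 2 - x) := fun F =>
    Finset.sum_nbij' (fun x => N - 2 - x) (fun x => N - 2 - x)
      (fun x hx => by simp only [Finset.mem_Ico, Finset.mem_range] at hx ⊢; omega)
      (fun x hx => by simp only [Finset.mem_Ico, Finset.mem_range] at hx ⊢; omega)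
      (fun x hx => by simp only [Finset.mem_Ico] at hx; omega)
      (fun x hx => by simp only [Finset.mem_range] at hx; omega)
      (fun x hx => by
        simp only [Finset.mem_Ico] at hx
        rw [show N - 2 - (N - 2 - x) = x by omega])
  -- The reflection `x ↦ N - 2 - x` of bonds carries this case to a sum starting at `0`; it reverses
  -- each difference, hence the minus sign.
  refine ⟨fun x => if N - 1 - L ≤ x then -(((L : ℝ) - (N - 2 - x : ℕ)) / L) else 0, ?_,
    fun η => ?_⟩
  · simp only [apply_ite abs, abs_zero, ← Finset.sum_filter, hfil]
    refine (Finset.sum_le_card_nsmul _ _ 1 fun x hx => ?_).trans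
      (by simp [Nat.sub_sub_self (show L ≤ N - 1 by omega)])
    rw [Finset.mem_Ico] at hx
    have h1 : (0 : ℝ) ≤ (N - 2 - x : ℕ) := Nat.cast_nonneg _
    have h2 : ((N - 2 - x : ℕ) : ℝ) ≤ L := by exact_mod_cast (by omega : N - 2 - x ≤ L)
    rw [abs_neg, abs_of_nonneg (div_nonneg (by linarith) hL0.le), div_le_one hL0]
    linarith
  · simp only [ite_mul, zero_mul, ← Finset.sum_filter, hfil]
    have h := sum_range_mul_sub (fun x => (occ η (N - 1 - x) : ℝ)) L
    rw [leftAverage, hsum, hsum]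
    have e : ∀ x ∈ Finset.range L, -(((L : ℝ) - (N - 2 - (N - 2 - x) : ℕ)) / L)
          * ((occ η (N - 2 - x) : ℝ) - occ η (N - 2 - x + 1))
        = 1 / L * (((L : ℝ) - x) * ((occ η (N - 1 - x) : ℝ) - occ η (N - 1 - (x + 1)))) := by
      intro x hx
      rw [Finset.mem_range] at hx
      rw [show N - 2 - (N - 2 - x) = x by omega, show N - 2 - x + 1 = N - 1 - x by omega,
        show N - 1 - (x + 1) = N - 2 - x by omega]
      ring
    have e' : ∀ x, N - 1 - (x + 1) = N - 2 - x := fun x => by omega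
    rw [Finset.sum_congr rfl e, ← Finset.mul_sum, h]
    simp only [e', Nat.sub_zero]
    field_simp

/-- The limit of bounds that hold eventually. -/
theorem tendsto_limsup_of_eventually_le {a : ℝ → ℕ → ENNReal} {b : ℝ → ℝ} {κ₀ : ℝ}
    (hκ₀ : 0 < κ₀) (hb : Tendsto b (𝓝[>] 0) (𝓝 0))
    (h : ∀ κ, 0 < κ → κ < κ₀ → ∀ᶠ N in atTop, a κ N ≤ ENNReal.ofReal (b κ)) :
    Tendsto (fun κ => limsup (a κ) atTop) (𝓝[>] 0) (𝓝 0) := by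
  have hb' : Tendsto (fun κ => ENNReal.ofReal (b κ)) (𝓝[>] 0) (𝓝 0) := by
    simpa using ENNReal.tendsto_ofReal hb
  refine tendsto_of_tendsto_of_tendsto_of_le_of_le' tendsto_const_nhds hb'
    (Eventually.of_forall fun _ => zero_le) ?_
  filter_upwards [Ioo_mem_nhdsGT hκ₀] with κ hκ
  exact limsup_le_of_le (by isBoundedDefault) (h κ hκ.1 hκ.2)

/-- The bound on the replacement error is uniform for large systems. -/
theorem replacement_bound {κ t : ℝ} (hκ : 0 < κ) (hκ' : κ < 1 / 4) (ht : 0 ≤ t) (α : ℕ) :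
    ∀ᶠ N : ℕ in atTop, 3 ≤ N ∧ 1 ≤ ⌊κ * (N : ℝ)⌋₊ ∧ ⌊κ * (N : ℝ)⌋₊ + 2 ≤ N ∧
      √(2 * t * (2 * (2 * α) * ((N - 1 : ℕ) * (2 * (⌊κ * (N : ℝ)⌋₊ : ℝ)) / (N : ℝ) ^ 2)))
        + t * ((⌊κ * (N : ℝ)⌋₊ : ℝ) / (N - 2 : ℕ) * α)
      ≤ √(2 * t * (2 * (2 * α) * (2 * κ))) + t * (2 * κ * α) := by
  -- `N ≥ 4` gives `N ≤ 2(N - 2)`, the source of the factor `2` in `2κ` in the error term, and `N ≥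
  -- 1/κ` makes the window nonempty.
  filter_upwards [eventually_ge_atTop 4, eventually_ge_atTop ⌈1 / κ⌉₊] with N h4 hN
  have hNr : (4 : ℝ) ≤ N := by exact_mod_cast h4
  have hκN : 1 ≤ κ * N := by
    have := Nat.ceil_le.1 hN
    rwa [div_le_iff₀ hκ, mul_comm] at this
  have hfl : (⌊κ * (N : ℝ)⌋₊ : ℝ) ≤ κ * N := Nat.floor_le (by positivity)
  have hL2 : ⌊κ * (N : ℝ)⌋₊ + 2 ≤ N := by
    have : ((⌊κ * (N : ℝ)⌋₊ + 2 : ℕ) : ℝ) ≤ N := by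
      push_cast
      nlinarith
    exact_mod_cast this
  refine ⟨by omega, Nat.le_floor (by simpa using hκN), hL2, ?_⟩
  have h1 : ((N - 1 : ℕ) : ℝ) ≤ N := by exact_mod_cast Nat.sub_le _ _
  have h2 : (N : ℝ) ≤ 2 * (N - 2 : ℕ) := by exact_mod_cast (by omega : N ≤ 2 * (N - 2))
  have hn : (0 : ℝ) < (N - 2 : ℕ) := by exact_mod_cast (by omega : 0 < N - 2)
  have e1 : (N - 1 : ℕ) * (2 * (⌊κ * (N : ℝ)⌋₊ : ℝ)) / (N : ℝ) ^ 2 ≤ 2 * κ := by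
    rw [div_le_iff₀ (by positivity)]
    calc (N - 1 : ℕ) * (2 * (⌊κ * (N : ℝ)⌋₊ : ℝ)) ≤ N * (2 * (κ * N)) := by gcongr
      _ = 2 * κ * (N : ℝ) ^ 2 := by ring
  have e2 : (⌊κ * (N : ℝ)⌋₊ : ℝ) / (N - 2 : ℕ) ≤ 2 * κ := by
    rw [div_le_iff₀ hn]
    nlinarith
  gcongr

theorem tendsto_replacement_bound (t : ℝ) (α : ℕ) :
    Tendsto (fun κ : ℝ => √(2 * t * (2 * (2 * α) * (2 * κ))) + t * (2 * κ * α))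
      (𝓝[>] 0) (𝓝 0) := by
  have h : Continuous fun κ : ℝ => √(2 * t * (2 * (2 * α) * (2 * κ))) + t * (2 * κ * α) := by
    fun_prop
  exact tendsto_nhdsWithin_of_tendsto_nhds (by simpa using h.tendsto 0)

end Replacement

end SEP

end

theorem mainTheorem2 (α : ℕ) (hα : 1 ≤ α)
    (ε γ β δ : ℝ) (hε : 0 < ε) (hγ : 0 < γ) (hβ : 0 < β) (hδ : 0 < δ) (θ T : ℝ)
    (μ : ∀ N : ℕ, Measure (SEP.Config α N)) [∀ N, IsProbabilityMeasure (μ N)]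
    {Ω : ℕ → Type*} [∀ N, MeasurableSpace (Ω N)]
    (P : ∀ N : ℕ, Measure (Ω N)) [∀ N, IsProbabilityMeasure (P N)]
    (X : ∀ N : ℕ, ℝ → Ω N → SEP.Config α N)
    (hX : ∀ N : ℕ, 1 ≤ N → SEP.IsAcceleratedSEP α N ε γ β δ θ T (μ N) (P N) (X N))
    (t : ℝ) (ht : t ∈ Set.Icc 0 T) :
    Tendsto
      (fun κ : ℝ => limsup
        (fun N : ℕ => ∫⁻ ω, ENNReal.ofReal |∫ s in (0 : ℝ)..t,
          ((SEP.occ (X N s ω) 1 : ℝ)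
            - SEP.rightAverage (X N s ω) ⌊κ * (N : ℝ)⌋₊ 1)| ∂(P N)) atTop)
      (𝓝[>] 0) (𝓝 0) ∧
    Tendsto
      (fun κ : ℝ => limsup
        (fun N : ℕ => ∫⁻ ω, ENNReal.ofReal |∫ s in (0 : ℝ)..t,
          ((SEP.occ (X N s ω) (N - 1) : ℝ)
            - SEP.leftAverage (X N s ω) ⌊κ * (N : ℝ)⌋₊ (N - 1))| ∂(P N)) atTop)
      (𝓝[>] 0) (𝓝 0) := by
  have hlim := SEP.tendsto_replacement_bound t α
  constructor
  · refine SEP.tendsto_limsup_of_eventually_le (κ₀ := 1 / 4) (by norm_num) hlim fun κ hκ hκ' => ?_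
    filter_upwards [SEP.replacement_bound hκ hκ' ht.1 α] with N ⟨h3, hL, hLN, hle⟩
    obtain ⟨g, hg, hgV⟩ := SEP.exists_rightAverage_eq (α := α) hL hLN
    exact (SEP.IsAcceleratedSEP.lintegral_abs_timeIntegral_le hα h3 hε.le hγ.le hβ.le hδ.le
      (hX N (by omega)) ht g hg (by exact_mod_cast (by omega))
      (fun η => (SEP.occ η 1 : ℝ) - SEP.rightAverage η ⌊κ * (N : ℝ)⌋₊ 1)
      (fun η => SEP.abs_sub_average_le η 1 _ hL _ (by simp)) hgV).trans
      (ENNReal.ofReal_le_ofReal hle)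
  · refine SEP.tendsto_limsup_of_eventually_le (κ₀ := 1 / 4) (by norm_num) hlim fun κ hκ hκ' => ?_
    filter_upwards [SEP.replacement_bound hκ hκ' ht.1 α] with N ⟨h3, hL, hLN, hle⟩
    obtain ⟨g, hg, hgV⟩ := SEP.exists_leftAverage_eq (α := α) hL hLN
    exact (SEP.IsAcceleratedSEP.lintegral_abs_timeIntegral_le hα h3 hε.le hγ.le hβ.le hδ.le
      (hX N (by omega)) ht g hg (by exact_mod_cast (by omega))
      (fun η => (SEP.occ η (N - 1) : ℝ) - SEP.leftAverage η ⌊κ * (N : ℝ)⌋₊ (N - 1))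
      (fun η => SEP.abs_sub_average_le η (N - 1) _ hL _ (by simp; omega)) hgV).trans
      (ENNReal.ofReal_le_ofReal hle)
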